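/- Let $\mathcal V$ be a finite alphabet, $L\ge 0$ an integer, and $(X_t)_{t\in\mathbb Z}$ a variable-length Markov chain (VLMC) on $\mathcal V$ of order at most $L$: there are a set $\mathcal T$ of contexts (words of length at most $L$ such that every word $x_{t-L+1}\dots x_t$ of length $L$ has exactly one suffix $c(x_{t-L+1}\dots x_t)$ in $\mathcal T$) and probability distributions $p(\cdot\mid c)$ on $\mathcal V$, $c\in\mathcal T$, such that for all $t\in\mathbb Z$, $n\ge L$ and $a\in\mathcal V$, $$P\bigl(X_{t+1}=a\mid X_{t-n+1}=x_{t-n+1},\dots,X_t=x_t\bigr)=p\bigl(a\mid c(x_{t-L+1}\dots x_t)\bigr)$$ whenever the conditioning event has positive probability. Assume that the induced Markov chain of length-$L$ contexts $(X_{t-L+1},\dots,X_t)$, on the set of words of length $L$ that occur with positive probability at some time, is irreducible and aperiodic. Then there are constants $C<\infty$ and $\rho\in(0,1)$ such that for every index $i\in\mathbb Z$, every spacing $d\ge 1$ and every $M\ge 0$, $$I\bigl(X_i;\,X_{i+d},X_{i+2d},\dots,X_{i+(M+1)d}\bigr)\le C\rho^{d},$$ where $I$ denotes mutual information. (The constants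 do not depend on $i$, $d$ or $M$.) -/

import Mathlib

open MeasureTheory
open scoped ENNReal

noncomputable section

/-- A probabilistic context tree over the alphabet `V` with contexts of length at most `L`: the
parameters of a variable-length Markov chain of order at most `L`. Pasts and contexts are read
from the most recent symbol backwards, so a context is a prefix of the list of past symbols. -/
structure ContextTree (V : Type*) (L : ℕ) where
  /-- The set of contexts. -/
  contexts : Set (List V)
  length_le : ∀ c ∈ contexts, c.length ≤ L
  /-- Every past has exactly one context. -/
  existsUnique_context : ∀ x : Fin L → V, ∃! c, c ∈ contexts ∧ c <+: List.ofFn x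
  /-- The law of the next symbol given a context. -/
  next : contexts → PMF V

namespace ContextTree

variable {V : Type*} {L : ℕ}

/-- The context function: the context of the past `x`, where `x 0` is the most recent symbol. -/
def context (T : ContextTree V L) (x : Fin L → V) : T.contexts :=
  ⟨(T.existsUnique_context x).choose, (T.existsUnique_context x).choose_spec.1.1⟩

/-- The word of the last `L` symbols after the symbol `a` has been appended to the past `x`. -/
def push (x : Fin L → V) (a : V) : Fin L → V :=
  fun j => (Fin.cons a x : Fin (L + 1) → V) j.castSucc

open scoped Classical in
/-- The transition matrix of the Markov chain that the context tree induces on words of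
length `L`. -/
def transitionMatrix [Fintype V] (T : ContextTree V L) : Matrix (Fin L → V) (Fin L → V) ℝ :=
  Matrix.of fun x y => ∑ a : V, if y = push x a then (T.next (T.context x) a).toReal else 0

end ContextTree

variable {Ω V : Type*} [MeasurableSpace Ω]

/-- The process `X` is a variable-length Markov chain with context tree `T`: given the last `n`
symbols, for any `n ≥ L`, the conditional law of the next symbol is the one attached to their
context. Here `w j` is the value at time `t - j`; the product form of the identity
says nothing about pasts of probability zero. -/
def IsVLMC {L : ℕ} (μ : Measure Ω) (X : ℤ → Ω → V) (T : ContextTree V L) : Prop :=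
  ∀ (t : ℤ) (n : ℕ) (hn : L ≤ n) (w : Fin n → V) (a : V),
    μ {ω | X (t + 1) ω = a ∧ ∀ j : Fin n, X (t - (j : ℕ)) ω = w j} =
      μ {ω | ∀ j : Fin n, X (t - (j : ℕ)) ω = w j} *
        T.next (T.context fun j : Fin L => w (Fin.castLE hn j)) a

/-- The length-`L` context of the process `X` at time `t`, most recent symbol first. -/
def contextAt (L : ℕ) (X : ℤ → Ω → V) (t : ℤ) (ω : Ω) : Fin L → V :=
  fun j => X (t - (j : ℕ)) ω

/-- The state space of the context chain: the words of length `L` that occur in the process with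
positive probability. -/
abbrev ContextState (L : ℕ) (μ : Measure Ω) (X : ℤ → Ω → V) : Type _ :=
  {x : Fin L → V // ∃ t : ℤ, μ {ω | contextAt L X t ω = x} ≠ 0}

/-- The transition matrix of the induced Markov chain of length-`L` contexts, on its state
space. -/
def contextChain {L : ℕ} [Fintype V] (T : ContextTree V L) (μ : Measure Ω) (X : ℤ → Ω → V) :
    Matrix (ContextState L μ X) (ContextState L μ X) ℝ :=
  T.transitionMatrix.submatrix Subtype.val Subtype.val

/-- A finite Markov chain with transition matrix `Q` is aperiodic: for every state `x` the
greatest common divisor of the possible return times `n ≥ 1` to `x` is `1`. -/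
def IsAperiodic {S : Type*} [Finite S] (Q : Matrix S S ℝ) : Prop :=
  letI := Fintype.ofFinite S
  letI := Classical.decEq S
  ∀ (x : S) (k : ℕ), (∀ n : ℕ, 1 ≤ n → 0 < (Q ^ n) x x → k ∣ n) → k = 1

/-- The mutual information (in nats) of two random variables: the Kullback-Leibler divergence of
their joint law from the product of their laws. -/
def mutualInfo {A B : Type*} [MeasurableSpace A] [MeasurableSpace B] (μ : Measure Ω)
    (Y : Ω → A) (Z : Ω → B) : ℝ≥0∞ :=
  InformationTheory.klDiv (μ.map fun ω => (Y ω, Z ω)) ((μ.map Y).prod (μ.map Z))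

end

/-!
The mutual information is bounded through the ratio of a joint probability to the product of its
marginals: if `P (a, z) ≤ (1 + ε) P a P z` for all values, then the log-likelihood ratio is at most
`log (1 + ε) ≤ ε`, and so is its mean (`mutualInfo_le_of_measureReal_le`). It remains to bound the
ratio for `a` a value of `X i` and `z` a value of the whole future progression, uniformly in its
length.

The length-`L` context at time `i + d - 1` separates the past from the future: given the context,
the future symbols are independent of every past event (`IsVLMC.measureReal_inter_next`,
`isFutureEvent_progression`). Hence the ratio for the future progression is a weighted average
of the ratios for the single contexts at that time (`IsFutureEvent.measureReal_inter_le`), which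
removes the dependence on `M`.

For the contexts, irreducibility and aperiodicity make some power of the transition matrix positive
(`Matrix.IsIrreducible.isPrimitive_of_isAperiodic`), so the rows of its `n`-th power merge at a
geometric rate (`Matrix.IsPrimitive.exists_pow_sub_pow_le`). The process runs since time `-∞`, so
the same positive power bounds the probability of each context below, uniformly in time, and the
additive error becomes a multiplicative one (`IsVLMC.exists_measureReal_inter_contextAt_le`). No
stationary law is needed.
-/

open scoped Matrix

/-! ### Finite Markov chains: positivity of a power and loss of memory -/

/-- An irreducible aperiodic finite Markov chain is primitive: some power of its transition matrix
has positive entries. The return times to each state generate a numerical semigroup of gcd one,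
which contains every large integer. -/
lemma Matrix.IsIrreducible.isPrimitive_of_isAperiodic {S : Type*} [Fintype S] [DecidableEq S]
    {Q : Matrix S S ℝ} (hQ : Q.IsIrreducible) (h : IsAperiodic Q) : Q.IsPrimitive := by
  have h' : ∀ (x : S) (k : ℕ), (∀ n : ℕ, 1 ≤ n → 0 < (Q ^ n) x x → k ∣ n) → k = 1 := by
    unfold IsAperiodic at h
    convert h
  have hnn : ∀ n x y, 0 ≤ (Q ^ n) x y := fun n x y => Matrix.pow_apply_nonneg hQ.nonneg n x y
  have hmul : ∀ m n x y z, 0 < (Q ^ m) x y → 0 < (Q ^ n) y z → 0 < (Q ^ (m + n)) x z := by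
    intro m n x y z h1 h2
    rw [pow_add, Matrix.mul_apply]
    exact Finset.sum_pos' (fun w _ => mul_nonneg (hnn m x w) (hnn n w z))
      ⟨y, Finset.mem_univ _, mul_pos h1 h2⟩
  have hret : ∀ x : S, ∃ n : ℕ, ∀ m ≥ n, 0 < (Q ^ m) x x := by
    intro x
    let s : Set ℕ := {n | 1 ≤ n ∧ 0 < (Q ^ n) x x}
    have hs : Nat.setGcd s = 1 :=
      h' x _ fun n hn hp => Nat.setGcd_dvd_of_mem (s := s) ⟨hn, hp⟩
    obtain ⟨n, hn⟩ := Nat.exists_mem_closure_of_ge s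
    refine ⟨n, fun m hm => ?_⟩
    refine AddSubmonoid.closure_induction (motive := fun m _ => 0 < (Q ^ m) x x)
      (fun m hm => hm.2) (by simp) (fun a b _ _ ha hb => hmul a b x x x ha hb)
      (hn m hm (by simp [hs]))
  choose r hr using hret
  choose k _ hk using (Matrix.isIrreducible_iff_exists_pow_pos hQ.nonneg).1 hQ
  refine ⟨hQ.nonneg, ∑ x, r x + ∑ x, ∑ y, k x y + 1, by omega, fun x y => ?_⟩
  have h1 : r x ≤ ∑ x, r x := Finset.single_le_sum (fun _ _ => Nat.zero_le _) (Finset.mem_univ x)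
  have h2 : k x y ≤ ∑ x, ∑ y, k x y :=
    (Finset.single_le_sum (f := k x) (fun _ _ => Nat.zero_le _) (Finset.mem_univ y)).trans
      (Finset.single_le_sum (f := fun x => ∑ y, k x y) (fun _ _ => Nat.zero_le _)
        (Finset.mem_univ x))
  have h3 := hmul _ _ x x y
    (hr x (∑ x, r x + ∑ x, ∑ y, k x y + 1 - k x y) (by omega)) (hk x y)
  rwa [Nat.sub_add_cancel (by omega)] at h3

/-- Averaging against a stochastic matrix whose entries are at least `δ` shrinks the oscillation
of a function by the factor `1 - δ`: each average gives weight `δ` at least to the maximum. -/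
lemma Matrix.mulVec_sub_mulVec_le {S : Type*} [Fintype S] [DecidableEq S] {P : Matrix S S ℝ}
    (hP : P ∈ rowStochastic ℝ S) {δ D : ℝ} (hδ : ∀ x y, δ ≤ P x y) {f : S → ℝ}
    (hf : ∀ x y, f x - f y ≤ D) (x y : S) : (P *ᵥ f) x - (P *ᵥ f) y ≤ (1 - δ) * D := by
  have hnn : ∀ x y, 0 ≤ P x y := fun x y => nonneg_of_mem_rowStochastic hP
  have hsum : ∀ x, ∑ y, P x y = 1 := sum_row_of_mem_rowStochastic hP
  have : Nonempty S := ⟨x⟩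
  obtain ⟨z, hz⟩ := Finite.exists_max f
  have hx : (P *ᵥ f) x ≤ f z := by
    calc ∑ w, P x w * f w ≤ ∑ w, P x w * f z :=
          Finset.sum_le_sum fun w _ => mul_le_mul_of_nonneg_left (hz w) (hnn x w)
      _ = f z := by rw [← Finset.sum_mul, hsum, one_mul]
  have hD : 0 ≤ D := by simpa using hf x x
  have hy : δ * D ≤ (P *ᵥ f) y - (f z - D) := by
    calc δ * D ≤ P y z * (f z - (f z - D)) := by
          rw [sub_sub_cancel]; exact mul_le_mul_of_nonneg_right (hδ y z) hD
      _ ≤ ∑ w, P y w * (f w - (f z - D)) :=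
          Finset.single_le_sum (f := fun w => P y w * (f w - (f z - D)))
            (fun w _ => mul_nonneg (hnn y w) (by linarith [hf z w])) (Finset.mem_univ z)
      _ = (P *ᵥ f) y - (f z - D) := by
          simp only [mul_sub, Finset.sum_sub_distrib, ← Finset.sum_mul, hsum]
          simp [Matrix.mulVec, dotProduct]
  linarith

/-- The rows of the powers of a primitive stochastic matrix merge geometrically fast. -/
lemma Matrix.IsPrimitive.exists_pow_sub_pow_le {S : Type*} [Fintype S] [DecidableEq S]
    {Q : Matrix S S ℝ} (hQ : Q.IsPrimitive) (hst : Q ∈ rowStochastic ℝ S) :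
    ∃ C ρ : ℝ, 0 ≤ C ∧ ρ ∈ Set.Ioo (0 : ℝ) 1 ∧
      ∀ n x y z, (Q ^ n) x z - (Q ^ n) y z ≤ C * ρ ^ n := by
  obtain ⟨N, hN, hpos⟩ := hQ.exists_pos_pow
  obtain ⟨δ, hδ0, hδ1, hδ⟩ : ∃ δ : ℝ, 0 < δ ∧ δ < 1 ∧ ∀ x y, δ ≤ (Q ^ N) x y := by
    cases isEmpty_or_nonempty S
    · exact ⟨1 / 2, by norm_num, by norm_num, fun x => isEmptyElim x⟩
    obtain ⟨p, hp⟩ := Finite.exists_min fun p : S × S => (Q ^ N) p.1 p.2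
    exact ⟨min ((Q ^ N) p.1 p.2) (1 / 2), lt_min (hpos _ _) (by norm_num),
      (min_le_right _ _).trans_lt (by norm_num), fun x y => (min_le_left _ _).trans (hp (x, y))⟩
  have hdecay : ∀ k r x y z,
      (Q ^ (N * k + r)) x z - (Q ^ (N * k + r)) y z ≤ (1 - δ) ^ k := by
    intro k r
    induction k with
    | zero =>
      intro x y z
      have h1 := le_one_of_mem_rowStochastic (pow_mem hst r) (i := x) (j := z)
      have h2 := nonneg_of_mem_rowStochastic (pow_mem hst r) (i := y) (j := z)
      simp only [mul_zero, zero_add, pow_zero]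
      linarith
    | succ k ih =>
      intro x y z
      have h := mulVec_sub_mulVec_le (pow_mem hst N) hδ
        (f := fun w => (Q ^ (N * k + r)) w z) (fun x y => ih x y z) x y
      rw [show N * (k + 1) + r = N + (N * k + r) by ring, pow_add, pow_succ']
      exact h
  have h1δ : 0 < 1 - δ := by linarith
  have hN' : (N : ℝ) ≠ 0 := by positivity
  have hρN : ((1 - δ) ^ (1 / (N : ℝ))) ^ N = 1 - δ := by
    rw [← Real.rpow_natCast, ← Real.rpow_mul h1δ.le, one_div_mul_cancel hN', Real.rpow_one]
  set ρ : ℝ := (1 - δ) ^ (1 / (N : ℝ)) with hρ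
  have hρ0 : 0 < ρ := Real.rpow_pos_of_pos h1δ _
  have hρ1 : ρ < 1 := Real.rpow_lt_one h1δ.le (by linarith) (by positivity)
  refine ⟨1 / (1 - δ), ρ, by positivity, ⟨hρ0, hρ1⟩, fun n x y z => ?_⟩
  have h := hdecay (n / N) (n % N) x y z
  rw [Nat.div_add_mod] at h
  refine h.trans ?_
  rw [one_div, inv_mul_eq_div, le_div_iff₀ h1δ]
  calc (1 - δ) ^ (n / N) * (1 - δ) = ρ ^ (N * (n / N) + N) := by
        rw [pow_add, pow_mul, hρN]
    _ ≤ ρ ^ n := by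
        refine pow_le_pow_of_le_one hρ0.le hρ1.le ?_
        have := Nat.div_add_mod n N
        have := Nat.mod_lt n hN
        omega

/-! ### Divergence and mutual information under a density bound -/

/-- If a probability measure is at most `1 + ε` times another one, then its Kullback-Leibler
divergence from it is at most `ε`: the log-likelihood ratio is at most `log (1 + ε) ≤ ε`. -/
lemma InformationTheory.klDiv_le_of_le_smul {α : Type*} [MeasurableSpace α] {μ ν : Measure α}
    [IsProbabilityMeasure μ] [IsProbabilityMeasure ν] {ε : ℝ} (hε : 0 ≤ ε)
    (h : μ ≤ ENNReal.ofReal (1 + ε) • ν) : klDiv μ ν ≤ ENNReal.ofReal ε := by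
  have hac : μ ≪ ν := Measure.absolutelyContinuous_of_le_smul h
  have hle : ∀ᵐ x ∂ν, (μ.rnDeriv ν x).toReal ≤ 1 + ε := by
    have : μ.rnDeriv ν ≤ᵐ[ν] fun _ => ENNReal.ofReal (1 + ε) := by
      refine ae_le_of_forall_setLIntegral_le_of_sigmaFinite (Measure.measurable_rnDeriv _ _)
        fun s hs _ => ?_
      calc ∫⁻ x in s, μ.rnDeriv ν x ∂ν ≤ μ s := Measure.setLIntegral_rnDeriv_le s
        _ ≤ (ENNReal.ofReal (1 + ε) • ν) s := h s
        _ = _ := by simp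
    filter_upwards [this] with x hx
    exact ENNReal.toReal_le_of_le_ofReal (by linarith) hx
  have hkl : ∀ᵐ x ∂ν, klFun (μ.rnDeriv ν x).toReal ≤
      ε * (μ.rnDeriv ν x).toReal + (1 - (μ.rnDeriv ν x).toReal) := by
    filter_upwards [hle] with x hx
    set r := (μ.rnDeriv ν x).toReal
    have hr : 0 ≤ r := ENNReal.toReal_nonneg
    have hlog : r * Real.log r ≤ r * ε := by
      rcases hr.eq_or_lt with h0 | h0
      · simp [← h0]
      · exact mul_le_mul_of_nonneg_left
          ((Real.log_le_sub_one_of_pos h0).trans (by linarith)) hr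
    rw [klFun_apply]
    linarith
  have hint : Integrable (fun x => (μ.rnDeriv ν x).toReal) ν := Measure.integrable_toReal_rnDeriv
  have hint1 : Integrable (fun x => 1 - (μ.rnDeriv ν x).toReal) ν :=
    (integrable_const 1).sub hint
  have hint' : Integrable (fun x => ε * (μ.rnDeriv ν x).toReal +
      (1 - (μ.rnDeriv ν x).toReal)) ν :=
    (hint.const_mul ε).add hint1
  have hklint : Integrable (fun x => klFun (μ.rnDeriv ν x).toReal) ν := by
    refine hint'.mono' (Measurable.aestronglyMeasurable (by fun_prop)) ?_
    filter_upwards [hkl] with x hx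
    rwa [Real.norm_of_nonneg (klFun_nonneg ENNReal.toReal_nonneg)]
  rw [klDiv_eq_integral_klFun, if_pos ⟨hac, (integrable_klFun_rnDeriv_iff hac).1 hklint⟩]
  refine ENNReal.ofReal_le_ofReal ((integral_mono_ae hklint hint' hkl).trans_eq ?_)
  rw [integral_add (hint.const_mul ε) hint1, integral_const_mul,
    integral_sub (integrable_const 1) hint, Measure.integral_toReal_rnDeriv hac]
  simp

/-- A bound on joint probabilities of single values by the product of their probabilities bounds
the mutual information. -/
lemma mutualInfo_le_of_measureReal_le {Ω A B : Type*} [MeasurableSpace Ω] {μ : Measure Ω}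
    [IsProbabilityMeasure μ] [Fintype A] [Fintype B] [MeasurableSpace A] [MeasurableSpace B]
    [MeasurableSingletonClass A] [MeasurableSingletonClass B] {Y : Ω → A} {Z : Ω → B}
    (hY : Measurable Y) (hZ : Measurable Z) {ε : ℝ} (hε : 0 ≤ ε)
    (h : ∀ a b, μ.real ({ω | Y ω = a} ∩ {ω | Z ω = b}) ≤
      (1 + ε) * (μ.real {ω | Y ω = a} * μ.real {ω | Z ω = b})) :
    mutualInfo μ Y Z ≤ ENNReal.ofReal ε := by
  have : IsProbabilityMeasure (μ.map fun ω => (Y ω, Z ω)) :=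
    Measure.isProbabilityMeasure_map (hY.prodMk hZ).aemeasurable
  have : IsProbabilityMeasure (μ.map Y) := Measure.isProbabilityMeasure_map hY.aemeasurable
  have : IsProbabilityMeasure (μ.map Z) := Measure.isProbabilityMeasure_map hZ.aemeasurable
  refine InformationTheory.klDiv_le_of_le_smul hε ?_
  have hpt : ∀ p : A × B, (μ.map fun ω => (Y ω, Z ω)) {p} ≤
      (ENNReal.ofReal (1 + ε) • (μ.map Y).prod (μ.map Z)) {p} := by
    rintro ⟨a, b⟩
    rw [Measure.smul_apply, smul_eq_mul, ← Set.singleton_prod_singleton, Measure.prod_prod,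
      Measure.map_apply (hY.prodMk hZ) (.prod (.singleton a) (.singleton b)),
      Measure.map_apply hY (.singleton a), Measure.map_apply hZ (.singleton b)]
    have h' := ENNReal.ofReal_le_ofReal (h a b)
    rw [ENNReal.ofReal_mul (by linarith), ENNReal.ofReal_mul measureReal_nonneg,
      ofReal_measureReal, ofReal_measureReal, ofReal_measureReal] at h'
    exact h'
  refine Measure.le_iff.2 fun s _ => ?_
  classical
  rw [← s.toFinite.coe_toFinset, ← sum_measure_singleton, ← sum_measure_singleton]
  exact Finset.sum_le_sum fun p _ => hpt p

/-! ### Past events and the Markov property -/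

section PastAndFuture

variable {Ω V : Type*}

/-- `E` is an event of the past at time `t`: it is determined by finitely many of the symbols
`X t, X (t - 1), …`. It is encoded as a set that contains, with an outcome, all outcomes with the
same last `n` symbols. -/
def IsPastEvent (X : ℤ → Ω → V) (t : ℤ) (E : Set Ω) : Prop :=
  ∃ n : ℕ, ∀ ω ω', (∀ j : ℕ, j < n → X (t - j) ω = X (t - j) ω') → ω ∈ E → ω' ∈ E

namespace IsPastEvent

variable {X : ℤ → Ω → V} {t : ℤ} {E F : Set Ω}

lemma univ : IsPastEvent X t Set.univ := ⟨0, by simp⟩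

lemma inter (hE : IsPastEvent X t E) (hF : IsPastEvent X t F) : IsPastEvent X t (E ∩ F) := by
  obtain ⟨n, hn⟩ := hE
  obtain ⟨m, hm⟩ := hF
  exact ⟨max n m, fun ω ω' h hω =>
    ⟨hn ω ω' (fun j hj => h j (hj.trans_le (le_max_left _ _))) hω.1,
      hm ω ω' (fun j hj => h j (hj.trans_le (le_max_right _ _))) hω.2⟩⟩

lemma succ (hE : IsPastEvent X t E) : IsPastEvent X (t + 1) E := by
  obtain ⟨n, hn⟩ := hE
  refine ⟨n + 1, fun ω ω' h => hn ω ω' fun j hj => ?_⟩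
  have := h (j + 1) (by omega)
  rwa [show t + 1 - ((j + 1 : ℕ) : ℤ) = t - j by push_cast; ring] at this

lemma symbol (a : V) : IsPastEvent X t {ω | X t ω = a} := by
  refine ⟨1, fun ω ω' h hω => ?_⟩
  have h0 : X t ω = X t ω' := by simpa using h 0 one_pos
  exact h0.symm.trans hω

lemma contextAt {L : ℕ} (x : Fin L → V) : IsPastEvent X t {ω | contextAt L X t ω = x} := by
  refine ⟨L, fun ω ω' h hω => ?_⟩
  rw [Set.mem_ofPred_eq] at hω ⊢
  rw [← hω]
  exact funext fun j => (h j j.2).symm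

end IsPastEvent

lemma contextAt_succ {L : ℕ} (X : ℤ → Ω → V) (t : ℤ) (ω : Ω) :
    contextAt L X (t + 1) ω = ContextTree.push (contextAt L X t ω) (X (t + 1) ω) := by
  cases L with
  | zero => exact funext fun j => j.elim0
  | succ L =>
    funext j
    refine Fin.cases ?_ (fun k => ?_) j
    · simp [contextAt, ContextTree.push]
    · simp only [contextAt, ContextTree.push, Fin.castSucc_succ, Fin.cons_succ, Fin.val_succ,
        Fin.val_castSucc]
      congr 1
      push_cast
      ring

variable [MeasurableSpace Ω] {μ : Measure Ω}

lemma measureReal_inter_contextAt_eq_zero {L : ℕ} {X : ℤ → Ω → V} {t : ℤ} {E : Set Ω}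
    {x : Fin L → V} (hx : x ∉ Set.range (Subtype.val : ContextState L μ X → Fin L → V)) :
    μ.real (E ∩ {ω | contextAt L X t ω = x}) = 0 := by
  have h0 : μ {ω | contextAt L X t ω = x} = 0 := by
    by_contra hne
    exact hx ⟨⟨x, t, hne⟩, rfl⟩
  rw [measureReal_def, measure_mono_null Set.inter_subset_right h0, ENNReal.toReal_zero]

variable [IsProbabilityMeasure μ]

/-- The law of total probability for a random variable with finitely many values. -/
lemma measureReal_eq_sum_inter_fiber {α : Type*} [Fintype α] [MeasurableSpace α]
    [MeasurableSingletonClass α] {f : Ω → α} (hf : Measurable f) (A : Set Ω) :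
    μ.real A = ∑ x, μ.real (A ∩ {ω | f ω = x}) := by
  have h := sum_measureReal_preimage_singleton (μ := μ.restrict A) (f := f) Finset.univ
    fun x _ => hf (measurableSet_singleton x)
  rw [Finset.coe_univ, Set.preimage_univ, measureReal_restrict_apply_univ] at h
  rw [← h]
  refine Finset.sum_congr rfl fun x _ => ?_
  rw [measureReal_restrict_apply (hf (measurableSet_singleton x)), Set.inter_comm]
  rfl

variable [MeasurableSpace V] {L : ℕ} {T : ContextTree V L} {X : ℤ → Ω → V}

lemma measurable_contextAt (hX : ∀ t, Measurable (X t)) (t : ℤ) :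
    Measurable (contextAt L X t) :=
  measurable_pi_lambda _ fun _ => hX _

variable [Fintype V] [MeasurableSingletonClass V]

/-- The Markov property: given the context, the next symbol is independent of any past event. -/
lemma IsVLMC.measureReal_inter_next (hT : IsVLMC μ X T) (hX : ∀ t, Measurable (X t)) {t : ℤ}
    {E : Set Ω} (hE : IsPastEvent X t E) (x : Fin L → V) (a : V) :
    μ.real (E ∩ {ω | contextAt L X t ω = x} ∩ {ω | X (t + 1) ω = a}) =
      μ.real (E ∩ {ω | contextAt L X t ω = x}) * (T.next (T.context x) a).toReal := by
  obtain ⟨n, hn⟩ := hE.inter (IsPastEvent.contextAt (L := L) x)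
  set E' := E ∩ {ω | contextAt L X t ω = x} with hE'
  -- A window of length at least `L` reveals both the event and the context.
  let W : Ω → Fin (max n L) → V := fun ω j => X (t - (j : ℕ)) ω
  have hW : Measurable W := measurable_pi_lambda _ fun _ => hX _
  rw [measureReal_eq_sum_inter_fiber hW, measureReal_eq_sum_inter_fiber hW E', Finset.sum_mul]
  refine Finset.sum_congr rfl fun w _ => ?_
  by_cases hw : ∃ ω ∈ E', W ω = w
  · obtain ⟨ω₀, h₀, rfl⟩ := hw
    have hsub : {ω | W ω = W ω₀} ⊆ E' := fun ω hω =>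
      hn ω₀ ω (fun j hj => (congrFun hω ⟨j, hj.trans_le (le_max_left _ _)⟩).symm) h₀
    have hx : (fun j : Fin L => W ω₀ (Fin.castLE (le_max_right n L) j)) = x := h₀.2
    have h := congrArg ENNReal.toReal (hT t _ (le_max_right n L) (W ω₀) a)
    rw [hx, ENNReal.toReal_mul] at h
    rw [Set.inter_eq_self_of_subset_right hsub, Set.inter_right_comm,
      Set.inter_eq_self_of_subset_right hsub]
    convert h using 1
    · rw [measureReal_def]
      congr 2
      ext ω
      simp [W, funext_iff, and_comm]
    · rw [measureReal_def]
      congr 3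
      ext ω
      simp [W, funext_iff]
  · have h0 : E' ∩ {ω | W ω = w} = ∅ :=
      Set.eq_empty_of_forall_notMem fun ω hω => hw ⟨ω, hω.1, hω.2⟩
    rw [Set.inter_right_comm, h0]
    simp

/-! ### Future events -/

/-- `F` is an event of the future at time `t`: given the context at time `t`, it is independent of
the past. The number `g` is its conditional probability given the context `s`. -/
def IsFutureEvent (L : ℕ) (μ : Measure Ω) (X : ℤ → Ω → V) (t : ℤ) (F : Set Ω) : Prop :=
  ∀ s : Fin L → V, ∃ g : ℝ, 0 ≤ g ∧ ∀ E, IsPastEvent X t E →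
    μ.real (E ∩ {ω | contextAt L X t ω = s} ∩ F) =
      μ.real (E ∩ {ω | contextAt L X t ω = s}) * g

lemma IsFutureEvent.symbol_inter (hT : IsVLMC μ X T) (hX : ∀ t, Measurable (X t)) {t : ℤ}
    {F : Set Ω} (hF : IsFutureEvent L μ X (t + 1) F) (a : V) :
    IsFutureEvent L μ X t ({ω | X (t + 1) ω = a} ∩ F) := by
  intro s
  obtain ⟨g, hg, h⟩ := hF (ContextTree.push s a)
  refine ⟨(T.next (T.context s) a).toReal * g, by positivity, fun E hE => ?_⟩
  have hE' : IsPastEvent X (t + 1)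
      (E ∩ {ω | contextAt L X t ω = s} ∩ {ω | X (t + 1) ω = a}) :=
    (hE.inter (IsPastEvent.contextAt s)).succ.inter (IsPastEvent.symbol a)
  have h' := h _ hE'
  have hsub : E ∩ {ω | contextAt L X t ω = s} ∩ {ω | X (t + 1) ω = a} ⊆
      {ω | contextAt L X (t + 1) ω = ContextTree.push s a} := by
    rintro ω ⟨⟨-, h1⟩, h2⟩
    simp only [Set.mem_ofPred_eq] at h1 h2 ⊢
    rw [contextAt_succ, h1, h2]
  rw [Set.inter_eq_left.2 hsub, hT.measureReal_inter_next hX hE] at h'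
  rw [← Set.inter_assoc, h', mul_assoc]

lemma IsFutureEvent.of_succ (hT : IsVLMC μ X T) (hX : ∀ t, Measurable (X t)) {t : ℤ}
    {F : Set Ω} (hF : IsFutureEvent L μ X (t + 1) F) : IsFutureEvent L μ X t F := by
  intro s
  choose g hg h using fun a => hF.symbol_inter hT hX a s
  refine ⟨∑ a, g a, Finset.sum_nonneg fun a _ => hg a, fun E hE => ?_⟩
  rw [measureReal_eq_sum_inter_fiber (hX (t + 1)), Finset.mul_sum]
  refine Finset.sum_congr rfl fun a _ => ?_
  rw [← h a E hE, Set.inter_assoc _ F, Set.inter_comm F]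

lemma IsFutureEvent.of_add (hT : IsVLMC μ X T) (hX : ∀ t, Measurable (X t)) {t : ℤ}
    {F : Set Ω} (n : ℕ) (hF : IsFutureEvent L μ X (t + n) F) : IsFutureEvent L μ X t F := by
  induction n with
  | zero => simpa using hF
  | succ n ih =>
    refine ih (IsFutureEvent.of_succ hT hX ?_)
    rwa [Nat.cast_succ, ← add_assoc] at hF

/-- The values of the process along an arithmetic progression form a future event. -/
lemma isFutureEvent_progression (hT : IsVLMC μ X T) (hX : ∀ t, Measurable (X t)) (e M : ℕ)
    (t : ℤ) (z : Fin M → V) :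
    IsFutureEvent L μ X (t + e)
      {ω | (fun j : Fin M => X (t + ((j : ℕ) + 1) * (e + 1 : ℕ)) ω) = z} := by
  induction M generalizing t with
  | zero =>
    have huniv : IsFutureEvent L μ X (t + e) Set.univ :=
      fun _ => ⟨1, zero_le_one, fun E _ => by simp⟩
    convert huniv
    exact Set.eq_univ_of_forall fun ω => funext fun j => j.elim0
  | succ M ih =>
    have h := (ih (t + e + 1) (Fin.tail z)).of_add hT hX
    have h' := h.symbol_inter hT hX (z 0)
    convert h' using 1
    ext ω
    simp only [Set.mem_inter_iff, Set.mem_ofPred_eq, funext_iff, Fin.forall_fin_succ, Fin.tail]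
    refine and_congr (by simp [add_assoc]) (forall_congr' fun j => ?_)
    rw [show t + (((j.succ : Fin (M + 1)) : ℕ) + 1 : ℤ) * ((e + 1 : ℕ) : ℤ) =
      t + e + 1 + ((j : ℕ) + 1 : ℤ) * ((e + 1 : ℕ) : ℤ) by push_cast [Fin.val_succ]; ring]

/-! ### Evolution of the context -/

variable [Fintype (ContextState L μ X)]

lemma IsVLMC.measureReal_inter_contextAt_succ (hT : IsVLMC μ X T) (hX : ∀ t, Measurable (X t))
    {t : ℤ} {E : Set Ω} (hE : IsPastEvent X t E) (y : ContextState L μ X) :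
    μ.real (E ∩ {ω | contextAt L X (t + 1) ω = y}) =
      ∑ x : ContextState L μ X, μ.real (E ∩ {ω | contextAt L X t ω = x}) *
        contextChain T μ X x y := by
  classical
  have h : μ.real (E ∩ {ω | contextAt L X (t + 1) ω = y}) =
      ∑ x : Fin L → V, μ.real (E ∩ {ω | contextAt L X t ω = x}) *
        T.transitionMatrix x y := by
    rw [measureReal_eq_sum_inter_fiber (measurable_contextAt (L := L) hX t)]
    refine Finset.sum_congr rfl fun x _ => ?_
    rw [measureReal_eq_sum_inter_fiber (hX (t + 1)), ContextTree.transitionMatrix,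
      Matrix.of_apply, Finset.mul_sum]
    refine Finset.sum_congr rfl fun a _ => ?_
    rw [mul_ite, mul_zero, ← hT.measureReal_inter_next hX hE]
    split_ifs with hy
    · congr 1
      ext ω
      simp only [Set.mem_inter_iff, Set.mem_ofPred_eq, contextAt_succ, hy]
      constructor
      · rintro ⟨⟨⟨h1, -⟩, h2⟩, h3⟩
        exact ⟨⟨h1, h2⟩, h3⟩
      · rintro ⟨⟨h1, h2⟩, h3⟩
        exact ⟨⟨⟨h1, by rw [h2, h3]⟩, h2⟩, h3⟩
    · convert measureReal_empty
      refine Set.eq_empty_of_forall_notMem fun ω hω => hy ?_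
      obtain ⟨⟨⟨-, h1⟩, h2⟩, h3⟩ := hω
      simp only [Set.mem_ofPred_eq, contextAt_succ] at h1 h2 h3
      rw [← h1, h2, h3]
  rw [h]
  refine (Fintype.sum_of_injective Subtype.val Subtype.val_injective _ _ (fun x hx => ?_)
    fun x => rfl).symm
  rw [measureReal_inter_contextAt_eq_zero hx, zero_mul]

/-- The `n`-step transition probabilities of the context chain, jointly with a past event. -/
lemma IsVLMC.measureReal_inter_contextAt_add [DecidableEq (ContextState L μ X)]
    (hT : IsVLMC μ X T) (hX : ∀ t, Measurable (X t)) (n : ℕ) {t : ℤ} {E : Set Ω}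
    (hE : IsPastEvent X t E) (y : ContextState L μ X) :
    μ.real (E ∩ {ω | contextAt L X (t + n) ω = y}) =
      ∑ x : ContextState L μ X, μ.real (E ∩ {ω | contextAt L X t ω = x}) *
        (contextChain T μ X ^ n) x y := by
  induction n generalizing t with
  | zero => simp [Matrix.one_apply]
  | succ n ih =>
    rw [show t + ((n + 1 : ℕ) : ℤ) = t + 1 + n by push_cast; ring, ih hE.succ]
    simp_rw [hT.measureReal_inter_contextAt_succ hX hE, pow_succ', Matrix.mul_apply,
      Finset.sum_mul, Finset.mul_sum, mul_assoc]
    exact Finset.sum_comm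

lemma measureReal_eq_sum_contextState (hX : ∀ t, Measurable (X t)) (t : ℤ) (E : Set Ω) :
    μ.real E = ∑ x : ContextState L μ X, μ.real (E ∩ {ω | contextAt L X t ω = x}) := by
  rw [measureReal_eq_sum_inter_fiber (measurable_contextAt (L := L) hX t)]
  exact (Fintype.sum_of_injective Subtype.val Subtype.val_injective _ _
    (fun _ hx => measureReal_inter_contextAt_eq_zero hx) fun _ => rfl).symm

/-- The words that occur with positive probability are closed under transitions of positive
probability, so the context chain restricted to them is stochastic. -/
lemma IsVLMC.contextChain_mem_rowStochastic [DecidableEq (ContextState L μ X)]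
    (hT : IsVLMC μ X T) (hX : ∀ t, Measurable (X t)) :
    contextChain T μ X ∈ Matrix.rowStochastic ℝ (ContextState L μ X) := by
  classical
  rw [Matrix.mem_rowStochastic_iff_sum]
  have hval : ∀ x y : ContextState L μ X, contextChain T μ X x y =
      ∑ a : V, if y.1 = ContextTree.push x.1 a then (T.next (T.context x.1) a).toReal else 0 := by
    intro x y
    simp only [contextChain, ContextTree.transitionMatrix, Matrix.submatrix_apply,
      Matrix.of_apply]
  refine ⟨fun x y => ?_, fun x => ?_⟩
  · rw [hval]
    exact Finset.sum_nonneg fun a _ => by split_ifs <;> simp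
  · have hpush : ∀ a, T.next (T.context x.1) a ≠ 0 →
        ∃ t : ℤ, μ {ω | contextAt L X t ω = ContextTree.push x.1 a} ≠ 0 := by
      intro a ha
      obtain ⟨t, ht⟩ := x.2
      refine ⟨t + 1, fun h0 => ?_⟩
      have h := hT.measureReal_inter_next hX (IsPastEvent.univ (t := t)) x.1 a
      rw [Set.univ_inter, measureReal_def, measure_mono_null _ h0, ENNReal.toReal_zero] at h
      · rcases mul_eq_zero.1 h.symm with h1 | h1
        · exact ht ((measureReal_eq_zero_iff).1 h1)
        · exact ha (((ENNReal.toReal_eq_zero_iff _).1 h1).resolve_right (PMF.apply_ne_top _ _))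
      · rintro ω ⟨h1, h2⟩
        simp only [Set.mem_ofPred_eq] at h1 h2 ⊢
        rw [contextAt_succ, h1, h2]
    simp_rw [hval]
    rw [Finset.sum_comm]
    have hsum : ∑ a, (T.next (T.context x.1) a).toReal = 1 := by
      rw [← ENNReal.toReal_sum fun a _ => PMF.apply_ne_top _ _,
        ← tsum_fintype (L := .unconditional _),
        PMF.tsum_coe, ENNReal.toReal_one]
    rw [← hsum]
    refine Finset.sum_congr rfl fun a _ => ?_
    by_cases ha : T.next (T.context x.1) a = 0
    · simp [ha]
    · rw [Finset.sum_eq_single (⟨_, hpush a ha⟩ : ContextState L μ X)]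
      · simp
      · intro y _ hy
        exact if_neg fun h => hy (Subtype.ext h)
      · simp

/-! ### Decay of the dependence -/

/-- Along a primitive context chain, the joint probability of a past event and a context exceeds
the product of their probabilities by a factor `1 + C * ρ ^ n` at most. Every context has
probability bounded below uniformly in time, since it can be reached from anywhere in a fixed
number of steps. -/
lemma IsVLMC.exists_measureReal_inter_contextAt_le [DecidableEq (ContextState L μ X)]
    (hT : IsVLMC μ X T) (hX : ∀ t, Measurable (X t)) (hprim : (contextChain T μ X).IsPrimitive) :
    ∃ C ρ : ℝ, 0 ≤ C ∧ ρ ∈ Set.Ioo (0 : ℝ) 1 ∧ ∀ (n : ℕ) (t : ℤ) (E : Set Ω),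
      IsPastEvent X t E → ∀ s : ContextState L μ X,
        μ.real (E ∩ {ω | contextAt L X (t + n) ω = s}) ≤
          (1 + C * ρ ^ n) * (μ.real E * μ.real {ω | contextAt L X (t + n) ω = s}) := by
  have hst := hT.contextChain_mem_rowStochastic hX
  obtain ⟨C, ρ, hC, hρ, hmix⟩ := hprim.exists_pow_sub_pow_le hst
  obtain ⟨N, -, hpos⟩ := hprim.exists_pos_pow
  obtain ⟨δ, hδ0, hδ⟩ : ∃ δ : ℝ, 0 < δ ∧ ∀ x y, δ ≤ (contextChain T μ X ^ N) x y := by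
    cases isEmpty_or_nonempty (ContextState L μ X)
    · exact ⟨1, one_pos, fun x => isEmptyElim x⟩
    obtain ⟨p, hp⟩ := Finite.exists_min fun p : ContextState L μ X × ContextState L μ X =>
      (contextChain T μ X ^ N) p.1 p.2
    exact ⟨_, hpos p.1 p.2, fun x y => hp (x, y)⟩
  have hlaw : ∀ (n : ℕ) (t : ℤ) (s : ContextState L μ X),
      μ.real {ω | contextAt L X (t + n) ω = s} =
        ∑ x : ContextState L μ X, μ.real {ω | contextAt L X t ω = x} *
          (contextChain T μ X ^ n) x s := by
    intro n t s
    simpa using hT.measureReal_inter_contextAt_add hX n (IsPastEvent.univ (t := t)) s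
  have htot : ∀ t : ℤ, ∑ x : ContextState L μ X, μ.real {ω | contextAt L X t ω = x} = 1 := by
    intro t
    simpa using (measureReal_eq_sum_contextState (L := L) (μ := μ) hX t Set.univ).symm
  have hlow : ∀ (t : ℤ) (s : ContextState L μ X), δ ≤ μ.real {ω | contextAt L X t ω = s} := by
    intro t s
    have h := hlaw N (t - N) s
    rw [sub_add_cancel] at h
    rw [h, ← one_mul δ, ← htot (t - N), Finset.sum_mul]
    exact Finset.sum_le_sum fun x _ => mul_le_mul_of_nonneg_left (hδ x s) measureReal_nonneg
  refine ⟨C / δ, ρ, by positivity, hρ, fun n t E hE s => ?_⟩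
  set p := μ.real {ω | contextAt L X (t + n) ω = s} with hp
  have hpt : ∀ x, (contextChain T μ X ^ n) x s ≤ p + C * ρ ^ n := by
    intro x
    calc (contextChain T μ X ^ n) x s
        = ∑ y : ContextState L μ X, μ.real {ω | contextAt L X t ω = y} *
            (contextChain T μ X ^ n) x s := by rw [← Finset.sum_mul, htot, one_mul]
      _ ≤ ∑ y : ContextState L μ X, μ.real {ω | contextAt L X t ω = y} *
            ((contextChain T μ X ^ n) y s + C * ρ ^ n) :=
          Finset.sum_le_sum fun y _ => mul_le_mul_of_nonneg_left
            (by linarith [hmix n x y s]) measureReal_nonneg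
      _ = p + C * ρ ^ n := by
          simp_rw [mul_add, Finset.sum_add_distrib, ← Finset.sum_mul, htot, one_mul, hp, hlaw]
  have hρn : 0 ≤ C * ρ ^ n := mul_nonneg hC (pow_nonneg hρ.1.le n)
  calc μ.real (E ∩ {ω | contextAt L X (t + n) ω = s})
      ≤ ∑ x : ContextState L μ X, μ.real (E ∩ {ω | contextAt L X t ω = x}) *
          (p + C * ρ ^ n) := by
        rw [hT.measureReal_inter_contextAt_add hX n hE]
        exact Finset.sum_le_sum fun x _ =>
          mul_le_mul_of_nonneg_left (hpt x) measureReal_nonneg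
    _ = μ.real E * (p + C * ρ ^ n * 1) := by
        rw [← Finset.sum_mul, ← measureReal_eq_sum_contextState hX, mul_one]
    _ ≤ μ.real E * (p + C * ρ ^ n * (p / δ)) := by
        have : 1 ≤ p / δ := (one_le_div hδ0).2 (hlow _ s)
        gcongr
    _ = _ := by field_simp

/-- If every context at time `t` has joint probability with the past event `E` at most `c`
times the product of their probabilities, then so has every event of the future at time `t`. -/
lemma IsFutureEvent.measureReal_inter_le (hX : ∀ t, Measurable (X t)) {t : ℤ} {E F : Set Ω}
    (hF : IsFutureEvent L μ X t F) (hE : IsPastEvent X t E) {c : ℝ}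
    (h : ∀ s : ContextState L μ X, μ.real (E ∩ {ω | contextAt L X t ω = s}) ≤
      c * (μ.real E * μ.real {ω | contextAt L X t ω = s})) :
    μ.real (E ∩ F) ≤ c * (μ.real E * μ.real F) := by
  choose g hg hgF using hF
  have hsplit : ∀ A, IsPastEvent X t A → μ.real (A ∩ F) =
      ∑ s : ContextState L μ X, μ.real (A ∩ {ω | contextAt L X t ω = s}) * g s := by
    intro A hA
    rw [measureReal_eq_sum_contextState (L := L) hX t]
    refine Finset.sum_congr rfl fun s _ => ?_
    rw [← hgF s A hA, Set.inter_right_comm]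
  have hF' := hsplit _ IsPastEvent.univ
  simp only [Set.univ_inter] at hF'
  rw [hsplit E hE, hF', Finset.mul_sum, Finset.mul_sum]
  refine Finset.sum_le_sum fun s _ => ?_
  calc _ ≤ c * (μ.real E * μ.real {ω | contextAt L X t ω = s}) * g s :=
        mul_le_mul_of_nonneg_right (h s) (hg s)
    _ = _ := by ring

end PastAndFuture

theorem lemma3 {Ω V : Type*} [MeasurableSpace Ω] (μ : Measure Ω) [IsProbabilityMeasure μ]
    [Fintype V] [MeasurableSpace V] [MeasurableSingletonClass V]
    (L : ℕ) (T : ContextTree V L)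
    (X : ℤ → Ω → V) (hX : ∀ t, Measurable (X t)) (hT : IsVLMC μ X T)
    (h_irred : (contextChain T μ X).IsIrreducible)
    (h_aper : IsAperiodic (contextChain T μ X)) :
    ∃ C ρ : ℝ, 0 ≤ C ∧ ρ ∈ Set.Ioo (0 : ℝ) 1 ∧
      ∀ (i : ℤ) (d : ℕ), 1 ≤ d → ∀ M : ℕ,
        mutualInfo μ (X i) (fun ω (j : Fin (M + 1)) => X (i + ((j : ℕ) + 1) * d) ω) ≤
          ENNReal.ofReal (C * ρ ^ d) := by
  classical
  obtain ⟨C, ρ, hC, hρ, h⟩ := hT.exists_measureReal_inter_contextAt_le hX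
    (h_irred.isPrimitive_of_isAperiodic h_aper)
  refine ⟨C / ρ, ρ, div_nonneg hC hρ.1.le, hρ, fun i d hd M => ?_⟩
  -- The context at time `i + d - 1` separates `X i` from the symbols from time `i + d` on, for
  -- `d < L` too; hence the exponent `d - 1`, which the division by `ρ` compensates.
  obtain ⟨e, rfl⟩ : ∃ e, d = e + 1 := ⟨d - 1, by omega⟩
  have hpow : C / ρ * ρ ^ (e + 1) = C * ρ ^ e := by
    have := hρ.1.ne'
    field_simp
    ring
  rw [hpow]
  refine mutualInfo_le_of_measureReal_le (hX i) (measurable_pi_lambda _ fun j => hX _)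
    (mul_nonneg hC (pow_nonneg hρ.1.le e)) fun a z => ?_
  have hpast : IsPastEvent X i {ω | X i ω = a} := IsPastEvent.symbol a
  have hpast' : ∀ n : ℕ, IsPastEvent X (i + n) {ω | X i ω = a} := by
    intro n
    induction n with
    | zero => simpa using hpast
    | succ n ih => simpa [add_assoc] using ih.succ
  exact (isFutureEvent_progression hT hX e (M + 1) i z).measureReal_inter_le hX (hpast' e)
    (h e i _ hpast)
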